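/- **Theorem 1.5 (Infinite-dimensional strict Bounded Real Lemma).** Let $\mathcal X,\mathcal U,\mathcal Y$ be complex Hilbert spaces and let $A:\mathcal X\to\mathcal X$, $B:\mathcal U\to\mathcal X$, $C:\mathcal X\to\mathcal Y$, $D:\mathcal U\to\mathcal Y$ be bounded linear operators, defining the discrete-time linear system $\Sigma$: $x(n+1)=Ax(n)+Bu(n)$, $y(n)=Cx(n)+Du(n)$, with transfer function $F_\Sigma(z)=D+zC(I-zA)^{-1}B$. Assume that $A$ is exponentially stable, i.e., its spectral radius is less than $1$. Call a bounded selfadjoint operator $T$ strictly positive-definite ($T\succ 0$) if there is $\delta>0$ with $\langle Tx,x\rangle\ge\delta\|x\|^2$ for all $x$, and write $P\prec Q$ if $Q-P\succ 0$. Then the following are equivalent: 1. $F_\Sigma$ is in the strict Schur class $\mathcal S^o(\mathcal U,\mathcal Y)$, i.e., $F_\Sigma$ is holomorphic on the open unit disk $\mathbb D$ with values in the bounded operators $\mathcal U\to\mathcal Y$, and there is $\rho<1$ with $\|F_\Sigma(z)\|\le\rho$ for all $z\in\mathbb D$; 2. there is a bounded strictly positive-definite operator $H$ on $\mathcal X$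 satisfying the strict KYP inequality $$\begin{bmatrix}A&B\\C&D\end{bmatrix}^*\begin{bmatrix}H&0\\0&I_{\mathcal Y}\end{bmatrix}\begin{bmatrix}A&B\\C&D\end{bmatrix}\prec\begin{bmatrix}H&0\\0&I_{\mathcal U}\end{bmatrix}.$$ -/

import Mathlib

namespace StrictBRL

variable {X X' U Y : Type*}
  [NormedAddCommGroup X] [InnerProductSpace ℂ X]
  [NormedAddCommGroup X'] [InnerProductSpace ℂ X']
  [NormedAddCommGroup U] [InnerProductSpace ℂ U]
  [NormedAddCommGroup Y] [InnerProductSpace ℂ Y]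

/-- The bounded operator `[A B; C D] : X ⊕ U → X' ⊕ Y` between Hilbert space (that is, `ℓ²`)
direct sums. -/
noncomputable def blockOp (A : X →L[ℂ] X') (B : U →L[ℂ] X') (C : X →L[ℂ] Y) (D : U →L[ℂ] Y) :
    WithLp 2 (X × U) →L[ℂ] WithLp 2 (X' × Y) :=
  ((WithLp.prodContinuousLinearEquiv 2 ℂ X' Y).symm : X' × Y →L[ℂ] WithLp 2 (X' × Y)) ∘L
    ((A.coprod B).prod (C.coprod D)) ∘L
    (WithLp.prodContinuousLinearEquiv 2 ℂ X U : WithLp 2 (X × U) →L[ℂ] X × U)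

theorem blockOp_apply (A : X →L[ℂ] X') (B : U →L[ℂ] X') (C : X →L[ℂ] Y) (D : U →L[ℂ] Y)
    (x : X) (u : U) :
    blockOp A B C D (WithLp.toLp 2 (x, u)) = WithLp.toLp 2 (A x + B u, C x + D u) :=
  rfl

/-- A bounded operator `T` is strictly positive-definite, `T ≻ 0`: it is selfadjoint and
`⟨T x, x⟩ ≥ δ ‖x‖²` for all `x`, for some `δ > 0`. -/
def StrictlyPosDef [CompleteSpace X] (T : X →L[ℂ] X) : Prop :=
  IsSelfAdjoint T ∧ ∃ δ : ℝ, 0 < δ ∧ ∀ x : X, δ * ‖x‖ ^ 2 ≤ RCLike.re (inner ℂ (T x) x)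

/-- `F(z) = D + z C (I - z A)⁻¹ B`, the transfer function of the system
`x(n+1) = A x(n) + B u(n)`, `y(n) = C x(n) + D u(n)`. (`Ring.inverse` is the inverse in the
algebra of bounded operators wherever `I - z A` is boundedly invertible, and `0` elsewhere.) -/
noncomputable def transferFunction (A : X →L[ℂ] X) (B : U →L[ℂ] X) (C : X →L[ℂ] Y)
    (D : U →L[ℂ] Y) (z : ℂ) : U →L[ℂ] Y :=
  D + z • (C ∘L Ring.inverse (1 - z • A) ∘L B)

/-- `F` restricts to a member of the strict Schur class: it is holomorphic (in operator norm) on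
the open unit disk, where its norm is bounded by some `ρ < 1`. -/
def StrictSchurClass (F : ℂ → (U →L[ℂ] Y)) : Prop :=
  DifferentiableOn ℂ F (Metric.ball 0 1) ∧
    ∃ ρ : ℝ, ρ < 1 ∧ ∀ z ∈ Metric.ball (0 : ℂ) 1, ‖F z‖ ≤ ρ

/-- The strict KYP inequality `M* (H ⊕ I_Y) M ≺ H ⊕ I_U` for `M = [A B; C D]`, where `P ≺ Q`
means that `Q - P` is strictly positive-definite. -/
def StrictKYP [CompleteSpace X] [CompleteSpace U] [CompleteSpace Y]
    (A : X →L[ℂ] X) (B : U →L[ℂ] X) (C : X →L[ℂ] Y) (D : U →L[ℂ] Y) (H : X →L[ℂ] X) : Prop :=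
  StrictlyPosDef
    (blockOp H 0 0 (ContinuousLinearMap.id ℂ U) -
      ContinuousLinearMap.adjoint (blockOp A B C D) ∘L
        blockOp H 0 0 (ContinuousLinearMap.id ℂ Y) ∘L blockOp A B C D)

end StrictBRL

/-! From the KYP inequality to the Schur class: for `r = (I - zA)⁻¹Bu`, the state `zr` under input
`u` moves to `A(zr) + Bu = r` with output `F(z)u`. The inequality at `(zr, u)`, with `H ≥ 0` and
`|z| ≤ 1`, leaves `‖F(z)u‖² ≤ (1 - δ)‖u‖²`.

Conversely, `H` is the available storage `⟨Hx, x⟩ = sup_v (‖Wx + Tv‖² - ‖v‖²)` over `ℓ²` inputs `v`,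
where `W` maps the initial state to the free output and `T` is the Toeplitz operator of the impulse
response. Parseval over roots of unity gives `‖T‖ ≤ ρ < 1` (`exists_toeplitz_lp`), so the supremum
is attained and quadratic in `x` (`exists_isSelfAdjoint_isMaxOn`). Delaying an optimal input by one
step gives the non-strict dissipation inequality (`exists_storage_of_norm_transferFunction_le`).

Strictness comes from appending `εx` and `εu` to the output: for small `ε` the norm bound stays
below 1, and the dissipation inequality gains `ε²(‖x‖² + ‖u‖²)`. -/

namespace StrictBRL

open Finset Filter Topology

/-! ### Parseval's identity over roots of unity -/

section Parseval

variable {E : Type*} [NormedAddCommGroup E] [InnerProductSpace ℂ E]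

theorem sum_pow_mul_star_of_isPrimitiveRoot {ω : ℂ} {M : ℕ} (hω : IsPrimitiveRoot ω M)
    (hM : M ≠ 0) {n m : ℕ} (hn : n < M) (hm : m < M) :
    ∑ j ∈ range M, star ((ω ^ j) ^ n) * (ω ^ j) ^ m = if n = m then (M : ℂ) else 0 := by
  have hnorm : star ω * ω = 1 := by
    have h := hω.norm'_eq_one hM
    rw [mul_comm, ← starRingEnd_apply, Complex.mul_conj, Complex.normSq_eq_norm_sq, h]
    simp
  have hterm : ∀ j, star ((ω ^ j) ^ n) * (ω ^ j) ^ m = (star ω ^ n * ω ^ m) ^ j := by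
    intro j
    rw [star_pow, star_pow, mul_pow, ← pow_mul, ← pow_mul, ← pow_mul, ← pow_mul, mul_comm j n,
      mul_comm j m]
  simp_rw [hterm]
  split_ifs with h
  · subst h
    rw [← mul_pow, hnorm]
    simp
  · have hne : star ω ^ n * ω ^ m ≠ 1 := by
      intro h1
      apply h
      refine (hω.pow_inj hm hn ?_).symm
      calc ω ^ m = (star ω * ω) ^ n * ω ^ m := by rw [hnorm]; simp
        _ = ω ^ n * (star ω ^ n * ω ^ m) := by rw [mul_pow]; ring
        _ = ω ^ n := by rw [h1, mul_one]
    have hpow : (star ω ^ n * ω ^ m) ^ M = 1 := by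
      rw [mul_pow, ← pow_mul, ← pow_mul, mul_comm n, mul_comm m, pow_mul, pow_mul, ← star_pow,
        hω.pow_eq_one]
      simp
    rw [geom_sum_eq hne, hpow, sub_self, zero_div]

/-- Parseval's identity for polynomials with vector coefficients, averaged over roots of unity. -/
theorem sum_norm_sq_eval_rootsOfUnity {ω : ℂ} {M : ℕ} (hω : IsPrimitiveRoot ω M)
    (hM : M ≠ 0) (a : ℕ → E) :
    ∑ j ∈ range M, ‖∑ n ∈ range M, (ω ^ j) ^ n • a n‖ ^ 2 = M * ∑ n ∈ range M, ‖a n‖ ^ 2 := by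
  have h : ((∑ j ∈ range M, ‖∑ n ∈ range M, (ω ^ j) ^ n • a n‖ ^ 2 : ℝ) : ℂ) =
      ((M * ∑ n ∈ range M, ‖a n‖ ^ 2 : ℝ) : ℂ) := by
    push_cast
    have hj : ∀ j, ((‖∑ n ∈ range M, (ω ^ j) ^ n • a n‖ : ℂ)) ^ 2 =
        ∑ n ∈ range M, ∑ m ∈ range M,
          star ((ω ^ j) ^ n) * (ω ^ j) ^ m * inner ℂ (a n) (a m) := by
      intro j
      refine (inner_self_eq_norm_sq_to_K (𝕜 := ℂ) (∑ n ∈ range M, (ω ^ j) ^ n • a n)).symm.trans ?_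
      rw [sum_inner]
      refine sum_congr rfl fun n _ => ?_
      rw [inner_sum]
      refine sum_congr rfl fun m _ => ?_
      rw [inner_smul_left, inner_smul_right, starRingEnd_apply, mul_assoc]
    simp_rw [hj]
    rw [sum_comm, mul_sum]
    refine sum_congr rfl fun n hn => ?_
    rw [sum_comm]
    have : ∀ m ∈ range M, ∑ j ∈ range M,
        star ((ω ^ j) ^ n) * (ω ^ j) ^ m * inner ℂ (a n) (a m) =
          if n = m then (M : ℂ) * inner ℂ (a n) (a m) else 0 := by
      intro m hm
      rw [← sum_mul, sum_pow_mul_star_of_isPrimitiveRoot hω hM (mem_range.1 hn) (mem_range.1 hm)]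
      split_ifs <;> simp
    rw [sum_congr rfl this, sum_ite_eq, if_pos hn, inner_self_eq_norm_sq_to_K]
    simp
  exact_mod_cast h

end Parseval

/-! ### Finite-horizon bounds for Toeplitz operators -/

section Toeplitz

variable {U Y : Type*} [NormedAddCommGroup U] [InnerProductSpace ℂ U]
  [NormedAddCommGroup Y] [InnerProductSpace ℂ Y]

/-- The convolution of an operator sequence with a vector sequence. -/
def convolve (h : ℕ → U →L[ℂ] Y) (u : ℕ → U) (n : ℕ) : Y :=
  ∑ p ∈ antidiagonal n, h p.1 (u p.2)

/-- Convolution is multiplication of generating polynomials, so Parseval turns a bound on the symbol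
into one on the coefficients. -/
theorem sum_norm_sq_convolve_le_of_polynomial (h : ℕ → U →L[ℂ] Y) {ρ : ℝ} {K N : ℕ}
    (hN : N ≤ K)
    (hρ : ∀ z : ℂ, ‖z‖ = 1 → ‖∑ k ∈ range K, z ^ k • h k‖ ≤ ρ) (u : ℕ → U) :
    ∑ n ∈ range N, ‖convolve h u n‖ ^ 2 ≤ ρ ^ 2 * ∑ n ∈ range N, ‖u n‖ ^ 2 := by
  rcases Nat.eq_zero_or_pos N with rfl | hNpos
  · simp
  -- The product of polynomials of degrees below `K` and `N` has degree below `K + N`, so this many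
  -- roots of unity cause no aliasing.
  set M := K + N with hMdef
  have hM : M ≠ 0 := by omega
  obtain ⟨ω, hω⟩ : ∃ ω : ℂ, IsPrimitiveRoot ω M := ⟨_, Complex.isPrimitiveRoot_exp M hM⟩
  let s := range K ×ˢ range N
  let c : ℕ → Y := fun m => ∑ p ∈ s with p.1 + p.2 = m, h p.1 (u p.2)
  let v : ℕ → U := fun n => if n < N then u n else 0
  have hprod : ∀ z : ℂ, ∑ m ∈ range M, z ^ m • c m =
      (∑ k ∈ range K, z ^ k • h k) (∑ m ∈ range M, z ^ m • v m) := by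
    intro z
    have hv : ∑ m ∈ range M, z ^ m • v m = ∑ n ∈ range N, z ^ n • u n := by
      rw [← sum_subset (range_mono (show N ≤ M by omega))]
      · exact sum_congr rfl fun n hn => by simp [v, mem_range.1 hn]
      · intro n _ hn
        simp [v, mem_range.not.1 hn]
    have hmaps : ∀ p ∈ s, p.1 + p.2 ∈ range M := by
      intro p hp
      simp only [s, mem_product, mem_range] at hp ⊢
      omega
    calc ∑ m ∈ range M, z ^ m • c m
        = ∑ m ∈ range M, ∑ p ∈ s with p.1 + p.2 = m, z ^ (p.1 + p.2) • h p.1 (u p.2) := by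
          refine sum_congr rfl fun m _ => ?_
          rw [smul_sum]
          exact sum_congr rfl fun p hp => by rw [(mem_filter.1 hp).2]
      _ = ∑ p ∈ s, z ^ (p.1 + p.2) • h p.1 (u p.2) := sum_fiberwise_of_maps_to hmaps _
      _ = _ := by
          rw [sum_product, hv, _root_.sum_apply]
          refine sum_congr rfl fun k _ => ?_
          rw [map_sum]
          refine sum_congr rfl fun n _ => ?_
          simp [pow_add, smul_smul, mul_comm]
  have hc : ∀ n ∈ range N, c n = convolve h u n := by
    intro n hn
    refine sum_congr ?_ fun _ _ => rfl
    ext p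
    simp only [s, mem_filter, mem_product, mem_range, HasAntidiagonal.mem_antidiagonal] at hn ⊢
    omega
  have key : (M : ℝ) * ∑ n ∈ range M, ‖c n‖ ^ 2 ≤ M * (ρ ^ 2 * ∑ n ∈ range M, ‖v n‖ ^ 2) := by
    rw [← sum_norm_sq_eval_rootsOfUnity hω hM, mul_left_comm,
      ← sum_norm_sq_eval_rootsOfUnity hω hM, mul_sum]
    refine sum_le_sum fun j _ => ?_
    rw [hprod, ← mul_pow]
    gcongr
    refine ContinuousLinearMap.le_of_opNorm_le _ (hρ _ ?_) _
    rw [norm_pow, hω.norm'_eq_one hM, one_pow]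
  have hMpos : (0 : ℝ) < M := by positivity
  calc ∑ n ∈ range N, ‖convolve h u n‖ ^ 2
      = ∑ n ∈ range N, ‖c n‖ ^ 2 := sum_congr rfl fun n hn => by rw [hc n hn]
    _ ≤ ∑ n ∈ range M, ‖c n‖ ^ 2 :=
        sum_le_sum_of_subset_of_nonneg (range_mono (by omega)) fun _ _ _ => by positivity
    _ ≤ ρ ^ 2 * ∑ n ∈ range M, ‖v n‖ ^ 2 := le_of_mul_le_mul_left key hMpos
    _ = ρ ^ 2 * ∑ n ∈ range N, ‖u n‖ ^ 2 := by
        congr 1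
        rw [← sum_subset (range_mono (show N ≤ M by omega))]
        · exact sum_congr rfl fun n hn => by simp [v, mem_range.1 hn]
        · intro n _ hn
          simp [v, mem_range.not.1 hn]

theorem norm_sum_range_sub_tsum_le [CompleteSpace Y] {h : ℕ → U →L[ℂ] Y}
    (hs : Summable fun k => ‖h k‖)
    {z : ℂ} (hz : ‖z‖ ≤ 1) (K : ℕ) :
    ‖∑ k ∈ range K, z ^ k • h k‖ ≤ ‖∑' k, z ^ k • h k‖ + ∑' k, ‖h (k + K)‖ := by
  have hle : ∀ k, ‖z ^ k • h k‖ ≤ ‖h k‖ := fun k => by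
    rw [norm_smul, norm_pow]
    exact mul_le_of_le_one_left (norm_nonneg _) (pow_le_one₀ (norm_nonneg _) hz)
  have hsum : Summable fun k => z ^ k • h k := Summable.of_norm_bounded hs hle
  rw [← hsum.sum_add_tsum_nat_add K]
  have htail : ‖∑' k, z ^ (k + K) • h (k + K)‖ ≤ ∑' k, ‖h (k + K)‖ :=
    tsum_of_norm_bounded ((summable_nat_add_iff K).2 hs).hasSum fun k => hle _
  calc ‖∑ k ∈ range K, z ^ k • h k‖
      = ‖(∑ k ∈ range K, z ^ k • h k + ∑' k, z ^ (k + K) • h (k + K)) -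
          ∑' k, z ^ (k + K) • h (k + K)‖ := by rw [add_sub_cancel_right]
    _ ≤ _ := (norm_sub_le _ _).trans (by gcongr)

/-- If the symbol `∑ zᵏ hₖ` has norm at most `ρ` on the open unit disk, then so has the block
lower triangular Toeplitz operator with entries `hₖ`, at every finite horizon. -/
theorem sum_norm_sq_convolve_le [CompleteSpace Y] {h : ℕ → U →L[ℂ] Y}
    (hs : Summable fun k => ‖h k‖)
    {ρ : ℝ} (hρ : ∀ z ∈ Metric.ball (0 : ℂ) 1, ‖∑' k, z ^ k • h k‖ ≤ ρ) (u : ℕ → U) (N : ℕ) :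
    ∑ n ∈ range N, ‖convolve h u n‖ ^ 2 ≤ ρ ^ 2 * ∑ n ∈ range N, ‖u n‖ ^ 2 := by
  have hK : ∀ K, ∀ z : ℂ, ‖z‖ = 1 →
      ‖∑ k ∈ range K, z ^ k • h k‖ ≤ ρ + ∑' k, ‖h (k + K)‖ := by
    intro K z hz
    have hmem : z ∈ closure (Metric.ball (0 : ℂ) 1) := by
      rw [closure_ball _ one_ne_zero]
      simp [hz]
    -- The bound is known on the open disk only; continuity of the truncated symbol carries it to
    -- the circle.
    have hcl : IsClosed {z : ℂ | ‖∑ k ∈ range K, z ^ k • h k‖ ≤ ρ + ∑' k, ‖h (k + K)‖} :=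
      isClosed_le (by fun_prop) continuous_const
    refine closure_minimal (fun w hw => ?_) hcl hmem
    refine (norm_sum_range_sub_tsum_le hs (by simpa using (mem_ball_zero_iff.1 hw).le) K).trans ?_
    gcongr
    exact hρ w hw
  have hlim : Tendsto (fun K => (ρ + ∑' k, ‖h (k + K)‖) ^ 2 * ∑ n ∈ range N, ‖u n‖ ^ 2) atTop
      (𝓝 ((ρ + 0) ^ 2 * ∑ n ∈ range N, ‖u n‖ ^ 2)) :=
    (((tendsto_sum_nat_add fun k => ‖h k‖).const_add ρ).pow 2).mul_const _
  rw [add_zero] at hlim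
  refine ge_of_tendsto hlim ?_
  filter_upwards [eventually_ge_atTop N] with K hNK
  exact sum_norm_sq_convolve_le_of_polynomial h hNK (hK K) u

end Toeplitz

end StrictBRL

namespace StrictBRL

open Finset Filter Topology

/-! ### Neumann series of the resolvent -/

section Neumann

variable {R : Type*} [NormedRing R] [NormedAlgebra ℂ R]

/-- By Gelfand's formula, `‖aⁿ‖ ≤ rⁿ` eventually, for any `r` strictly between the spectral radius
and 1. -/
theorem summable_norm_pow_of_spectralRadius_lt_one [CompleteSpace R] {a : R}
    (ha : spectralRadius ℂ a < 1) : Summable fun n : ℕ => ‖a ^ n‖ := by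
  obtain ⟨r, hr, hr1⟩ := ENNReal.lt_iff_exists_nnreal_btwn.1 ha
  have hr1' : r < 1 := by exact_mod_cast hr1
  have hev := (spectrum.pow_nnnorm_pow_one_div_tendsto_nhds_spectralRadius a).eventually_lt_const hr
  refine Summable.of_norm_bounded_eventually_nat
    (summable_geometric_of_lt_one r.coe_nonneg (by exact_mod_cast hr1')) ?_
  filter_upwards [hev, eventually_ge_atTop 1] with n hn hn1
  have hn0 : (n : ℝ) ≠ 0 := by positivity
  have h := ENNReal.rpow_le_rpow hn.le (Nat.cast_nonneg' n : (0 : ℝ) ≤ n)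
  rw [← ENNReal.rpow_mul, one_div, inv_mul_cancel₀ hn0, ENNReal.rpow_one,
    ENNReal.rpow_natCast] at h
  rw [norm_norm]
  exact_mod_cast h

theorem norm_smul_pow_le {z : ℂ} (hz : ‖z‖ ≤ 1) (a : R) (n : ℕ) :
    ‖(z • a) ^ n‖ ≤ ‖a ^ n‖ := by
  rw [smul_pow, norm_smul, norm_pow]
  exact mul_le_of_le_one_left (norm_nonneg _) (pow_le_one₀ (norm_nonneg _) hz)

variable [CompleteSpace R] {a : R}

theorem summable_smul_pow (hs : Summable fun n : ℕ => ‖a ^ n‖) {z : ℂ} (hz : ‖z‖ ≤ 1) :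
    Summable fun n : ℕ => (z • a) ^ n :=
  Summable.of_norm_bounded hs (norm_smul_pow_le hz a)

theorem isUnit_one_sub_smul (hs : Summable fun n : ℕ => ‖a ^ n‖) {z : ℂ} (hz : ‖z‖ ≤ 1) :
    IsUnit (1 - z • a) :=
  ⟨⟨_, _, (summable_smul_pow hs hz).one_sub_mul_tsum_pow,
    (summable_smul_pow hs hz).tsum_pow_mul_one_sub⟩, rfl⟩

theorem inverse_one_sub_smul (hs : Summable fun n : ℕ => ‖a ^ n‖) {z : ℂ} (hz : ‖z‖ ≤ 1) :
    Ring.inverse (1 - z • a) = ∑' n : ℕ, (z • a) ^ n :=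
  Ring.inverse_unit ⟨1 - z • a, _, (summable_smul_pow hs hz).one_sub_mul_tsum_pow,
    (summable_smul_pow hs hz).tsum_pow_mul_one_sub⟩

theorem norm_inverse_one_sub_smul_le (hs : Summable fun n : ℕ => ‖a ^ n‖) {z : ℂ}
    (hz : ‖z‖ ≤ 1) : ‖Ring.inverse (1 - z • a)‖ ≤ ∑' n : ℕ, ‖a ^ n‖ := by
  rw [inverse_one_sub_smul hs hz]
  exact tsum_of_norm_bounded hs.hasSum (norm_smul_pow_le hz a)

end Neumann

/-! ### Power series and holomorphy of the transfer function -/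

section ImpulseResponse

variable {X U Y : Type*}
  [NormedAddCommGroup X] [InnerProductSpace ℂ X]
  [NormedAddCommGroup U] [InnerProductSpace ℂ U]
  [NormedAddCommGroup Y] [InnerProductSpace ℂ Y]

/-- The Taylor coefficients at `0` of the transfer function. -/
def impulseResponse (A : X →L[ℂ] X) (B : U →L[ℂ] X) (C : X →L[ℂ] Y) (D : U →L[ℂ] Y) :
    ℕ → U →L[ℂ] Y
  | 0 => D
  | k + 1 => C ∘L (A ^ k) ∘L B

variable {A : X →L[ℂ] X}
  (B : U →L[ℂ] X) (C : X →L[ℂ] Y) (D : U →L[ℂ] Y)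

theorem summable_norm_impulseResponse (hs : Summable fun n : ℕ => ‖A ^ n‖) :
    Summable fun n => ‖impulseResponse A B C D n‖ := by
  rw [← summable_nat_add_iff 1]
  refine Summable.of_nonneg_of_le (fun _ => norm_nonneg _) (fun k => ?_)
    ((hs.mul_left ‖C‖).mul_right ‖B‖)
  rw [mul_assoc]
  refine (C.opNorm_comp_le _).trans ?_
  gcongr
  exact (A ^ k).opNorm_comp_le B

theorem hasSum_transferFunction [CompleteSpace X] (hs : Summable fun n : ℕ => ‖A ^ n‖) {z : ℂ} (hz : ‖z‖ ≤ 1) :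
    HasSum (fun k => z ^ k • impulseResponse A B C D k) (transferFunction A B C D z) := by
  rw [← hasSum_nat_add_iff' 1]
  have h := (summable_smul_pow hs hz).hasSum
  rw [← inverse_one_sub_smul hs hz] at h
  have h2 := ((h.mapL ((ContinuousLinearMap.compL ℂ U X X).flip B)).mapL
    (ContinuousLinearMap.compL ℂ U X Y C)).const_smul z
  have hterm : (fun k => z ^ (k + 1) • impulseResponse A B C D (k + 1)) =
      fun k => z • C ∘L ((z • A) ^ k) ∘L B := by
    funext k
    ext u
    simp [impulseResponse, smul_pow, pow_succ', smul_smul]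
  have hval : transferFunction A B C D z - ∑ i ∈ range 1, z ^ i • impulseResponse A B C D i =
      z • C ∘L Ring.inverse (1 - z • A) ∘L B := by
    simp [transferFunction, impulseResponse]
  rw [hterm, hval]
  exact h2

theorem differentiableOn_transferFunction [CompleteSpace X]
    (hs : Summable fun n : ℕ => ‖A ^ n‖) :
    DifferentiableOn ℂ (transferFunction A B C D) (Metric.ball 0 1) := by
  intro z hz
  have hu := isUnit_one_sub_smul hs (mem_ball_zero_iff.1 hz).le
  have h1 : DifferentiableAt ℂ (fun z : ℂ => Ring.inverse (1 - z • A)) z :=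
    (differentiableAt_inverse hu).comp z
      (f := fun z : ℂ => 1 - z • A) (by fun_prop)
  refine DifferentiableAt.differentiableWithinAt ?_
  have h2 : DifferentiableAt ℂ (fun z : ℂ => C ∘L Ring.inverse (1 - z • A) ∘L B) z :=
    (differentiableAt_const C).clm_comp (h1.clm_comp (differentiableAt_const B))
  exact (differentiableAt_const D).add (differentiableAt_id.smul h2)

end ImpulseResponse

/-! ### Maximizing an indefinite quadratic form -/

section QuadraticOptimization

open ContinuousLinearMap

variable {X V K : Type*}
  [NormedAddCommGroup X] [InnerProductSpace ℂ X] [CompleteSpace X]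
  [NormedAddCommGroup V] [InnerProductSpace ℂ V] [CompleteSpace V]
  [NormedAddCommGroup K] [InnerProductSpace ℂ K] [CompleteSpace K]

/-- For a strict contraction `T`, the supremum over `v` of `‖W x + T v‖² - ‖v‖²` is attained and
is the quadratic form in `x` of a bounded selfadjoint operator. -/
theorem exists_isSelfAdjoint_isMaxOn (W : X →L[ℂ] K) (T : V →L[ℂ] K) (hT : ‖T‖ < 1) :
    ∃ H : X →L[ℂ] X, IsSelfAdjoint H ∧
      (∀ x v, ‖W x + T v‖ ^ 2 - ‖v‖ ^ 2 ≤ RCLike.re (inner ℂ (H x) x)) ∧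
      ∀ x, ∃ v, RCLike.re (inner ℂ (H x) x) = ‖W x + T v‖ ^ 2 - ‖v‖ ^ 2 := by
  set S : K →L[ℂ] K := T ∘L adjoint T
  have hS : ‖S‖ < 1 := by
    calc ‖S‖ ≤ ‖T‖ * ‖adjoint T‖ := T.opNorm_comp_le _
      _ = ‖T‖ * ‖T‖ := by rw [LinearIsometryEquiv.norm_map]
      _ < 1 := mul_lt_one_of_nonneg_of_lt_one_left (norm_nonneg _) hT hT.le
  have hunit : IsUnit (1 - S) := isUnit_one_sub_of_norm_lt_one hS
  have hSsa : IsSelfAdjoint S := by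
    rw [ContinuousLinearMap.isSelfAdjoint_iff', adjoint_comp, adjoint_adjoint]
  -- Stationarity in `v` reads `v = T*(Wx + Tv)`; hence `q = Wx + Tv` solves `(1 - TT*)q = Wx`, and
  -- the maximizer is `v = T*q`.
  set R : K →L[ℂ] K := Ring.inverse (1 - S)
  have hRsa : IsSelfAdjoint R := ((IsSelfAdjoint.one _).sub hSsa).ringInverse
  have hval : ∀ x, RCLike.re (inner ℂ ((adjoint W ∘L R ∘L W) x) x) =
      ‖R (W x)‖ ^ 2 - ‖adjoint T (R (W x))‖ ^ 2 ∧ W x + T (adjoint T (R (W x))) = R (W x) := by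
    intro x
    have hq : R (W x) - T (adjoint T (R (W x))) = W x :=
      DFunLike.congr_fun (Ring.mul_inverse_cancel (1 - S) hunit) (W x)
    refine ⟨?_, by nth_rewrite 1 [← hq]; abel⟩
    simp only [ContinuousLinearMap.comp_apply]
    rw [adjoint_inner_left]
    nth_rewrite 2 [← hq]
    rw [inner_sub_right, map_sub, ← adjoint_inner_left T, inner_self_eq_norm_sq,
      inner_self_eq_norm_sq]
  refine ⟨adjoint W ∘L R ∘L W, ?_, fun x v => ?_, fun x => ⟨adjoint T (R (W x)), ?_⟩⟩
  · rw [ContinuousLinearMap.isSelfAdjoint_iff', adjoint_comp, adjoint_comp, adjoint_adjoint,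
      ContinuousLinearMap.isSelfAdjoint_iff'.1 hRsa, ContinuousLinearMap.comp_assoc]
  · obtain ⟨h1, h2⟩ := hval x
    rw [h1]
    set q := R (W x)
    -- Completing the square: for `v = T*q + e` the cross terms cancel, leaving the optimal value
    -- plus `‖Te‖² - ‖e‖² ≤ 0`.
    have hv : v = adjoint T q + (v - adjoint T q) := by abel
    set e := v - adjoint T q
    have hw : W x + T v = q + T e := by
      rw [hv, map_add, ← add_assoc, h2]
    have he : ‖T e‖ ≤ ‖e‖ := T.le_of_opNorm_le_of_le hT.le le_rfl |>.trans_eq (one_mul _)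
    have he2 : ‖T e‖ ^ 2 ≤ ‖e‖ ^ 2 := by gcongr
    rw [hw, hv, norm_add_sq (𝕜 := ℂ), norm_add_sq (𝕜 := ℂ), adjoint_inner_left]
    linarith
  · obtain ⟨h1, h2⟩ := hval x
    rw [h1, h2]

end QuadraticOptimization

end StrictBRL

namespace StrictBRL

open Finset Filter Topology
open scoped ENNReal

/-! ### Input and output operators on `ℓ²` -/

section SquareSummable

variable {U V Y : Type*}
  [NormedAddCommGroup U] [InnerProductSpace ℂ U]
  [NormedAddCommGroup V] [InnerProductSpace ℂ V]
  [NormedAddCommGroup Y] [InnerProductSpace ℂ Y]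

theorem hasSum_norm_sq {E : Type*} [NormedAddCommGroup E] (f : lp (fun _ : ℕ => E) 2) :
    HasSum (fun n => ‖f n‖ ^ 2) (‖f‖ ^ 2) := by
  simpa using lp.hasSum_norm (p := 2) (by simp) f

theorem exists_continuousLinearMap_lp (L : V →ₗ[ℂ] (ℕ → Y)) {c : ℝ} (hc : 0 ≤ c)
    (hL : ∀ v N, ∑ n ∈ range N, ‖L v n‖ ^ 2 ≤ (c * ‖v‖) ^ 2) :
    ∃ T : V →L[ℂ] lp (fun _ : ℕ => Y) 2, ‖T‖ ≤ c ∧ ∀ v n, T v n = L v n := by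
  have hfin : ∀ v (s : Finset ℕ), ∑ n ∈ s, ‖L v n‖ ^ (2 : ℝ≥0∞).toReal ≤
      (c * ‖v‖) ^ (2 : ℝ≥0∞).toReal := by
    intro v s
    obtain ⟨N, hN⟩ := s.exists_nat_subset_range
    have h := (sum_le_sum_of_subset_of_nonneg hN fun n _ _ => sq_nonneg ‖L v n‖).trans (hL v N)
    simpa using h
  have hmem : ∀ v, Memℓp (L v) 2 := fun v => memℓp_gen' (hfin v)
  let T : V →ₗ[ℂ] lp (fun _ : ℕ => Y) 2 :=
    { toFun := fun v => ⟨L v, hmem v⟩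
      map_add' := fun v w => Subtype.ext (L.map_add v w)
      map_smul' := fun a v => Subtype.ext (L.map_smul a v) }
  have hT : ∀ v, ‖T v‖ ≤ c * ‖v‖ := fun v =>
    lp.norm_le_of_forall_sum_le (by simp) (by positivity) (hfin v)
  exact ⟨T.mkContinuous c hT, T.mkContinuous_norm_le hc hT, fun v n => rfl⟩

theorem exists_lp_cons {E : Type*} [NormedAddCommGroup E] (u : E) (v : lp (fun _ : ℕ => E) 2) :
    ∃ w : lp (fun _ : ℕ => E) 2, w 0 = u ∧ (∀ n, w (n + 1) = v n) ∧
      ‖w‖ ^ 2 = ‖u‖ ^ 2 + ‖v‖ ^ 2 := by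
  let f : ℕ → E := fun n => Nat.casesOn n u v
  have hf : Memℓp f 2 := by
    refine memℓp_gen ?_
    rw [← summable_nat_add_iff 1]
    simpa [f] using (hasSum_norm_sq v).summable
  refine ⟨⟨f, hf⟩, rfl, fun n => rfl, ?_⟩
  have h := hasSum_norm_sq (⟨f, hf⟩ : lp (fun _ : ℕ => E) 2)
  rw [← hasSum_nat_add_iff' 1] at h
  have h2 := h.unique (hasSum_norm_sq v)
  simp only [sum_range_one] at h2
  change _ - ‖u‖ ^ 2 = _ at h2
  linarith

theorem exists_toeplitz_lp [CompleteSpace Y] {h : ℕ → U →L[ℂ] Y} (hs : Summable fun k => ‖h k‖)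
    {ρ : ℝ} (hρ : ∀ z ∈ Metric.ball (0 : ℂ) 1, ‖∑' k, z ^ k • h k‖ ≤ ρ) :
    ∃ T : lp (fun _ : ℕ => U) 2 →L[ℂ] lp (fun _ : ℕ => Y) 2, ‖T‖ ≤ ρ ∧
      ∀ u n, T u n = convolve h u n := by
  have hρ0 : 0 ≤ ρ := (norm_nonneg _).trans (hρ 0 (by simp))
  let L : lp (fun _ : ℕ => U) 2 →ₗ[ℂ] (ℕ → Y) :=
    { toFun := fun u => convolve h u
      map_add' := fun u v => by
        funext n
        simp [convolve, sum_add_distrib]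
      map_smul' := fun a u => by
        funext n
        simp [convolve, smul_sum] }
  refine exists_continuousLinearMap_lp L hρ0 fun u N => ?_
  refine (sum_norm_sq_convolve_le hs hρ u N).trans ?_
  rw [mul_pow]
  gcongr
  exact sum_le_hasSum _ (fun _ _ => sq_nonneg _) (hasSum_norm_sq u)

theorem exists_observability_lp {A : V →L[ℂ] V} (hs : Summable fun n : ℕ => ‖A ^ n‖)
    (C : V →L[ℂ] Y) :
    ∃ W : V →L[ℂ] lp (fun _ : ℕ => Y) 2, ∀ x n, W x n = C ((A ^ n) x) := by
  let L : V →ₗ[ℂ] (ℕ → Y) := LinearMap.pi fun n => ((C ∘L (A ^ n) : V →L[ℂ] Y) : V →ₗ[ℂ] Y)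
  have hc : 0 ≤ ‖C‖ * ∑' n : ℕ, ‖A ^ n‖ :=
    mul_nonneg (norm_nonneg _) (tsum_nonneg fun _ => norm_nonneg _)
  obtain ⟨W, -, hW⟩ := exists_continuousLinearMap_lp L hc fun x N => by
    refine (sum_sq_le_sq_sum_of_nonneg fun _ _ => norm_nonneg _).trans ?_
    gcongr
    calc ∑ n ∈ range N, ‖L x n‖ ≤ ∑ n ∈ range N, ‖C‖ * ‖A ^ n‖ * ‖x‖ := by
          refine sum_le_sum fun n _ => ?_
          rw [mul_assoc]
          exact C.le_opNorm_of_le ((A ^ n).le_opNorm x)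
      _ = ‖C‖ * (∑ n ∈ range N, ‖A ^ n‖) * ‖x‖ := by rw [mul_sum, sum_mul]
      _ ≤ _ := by
          gcongr
          exact hs.sum_le_tsum _ fun _ _ => norm_nonneg _
  exact ⟨W, hW⟩

end SquareSummable

/-! ### The available storage -/

section BoundedReal

variable {X U Y : Type*}
  [NormedAddCommGroup X] [InnerProductSpace ℂ X] [CompleteSpace X]
  [NormedAddCommGroup U] [InnerProductSpace ℂ U] [CompleteSpace U]
  [NormedAddCommGroup Y] [InnerProductSpace ℂ Y] [CompleteSpace Y]

/-- The available storage of a stable system whose transfer function has norm at most `ρ < 1` is a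
bounded nonnegative quadratic form satisfying the dissipation inequality. -/
theorem exists_storage_of_norm_transferFunction_le {A : X →L[ℂ] X}
    (hs : Summable fun n : ℕ => ‖A ^ n‖) (B : U →L[ℂ] X) (C : X →L[ℂ] Y) (D : U →L[ℂ] Y)
    {ρ : ℝ} (hρ1 : ρ < 1) (hρ : ∀ z ∈ Metric.ball (0 : ℂ) 1, ‖transferFunction A B C D z‖ ≤ ρ) :
    ∃ H : X →L[ℂ] X, IsSelfAdjoint H ∧ (∀ x, 0 ≤ RCLike.re (inner ℂ (H x) x)) ∧
      ∀ x u, RCLike.re (inner ℂ (H (A x + B u)) (A x + B u)) + ‖C x + D u‖ ^ 2 ≤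
        RCLike.re (inner ℂ (H x) x) + ‖u‖ ^ 2 := by
  obtain ⟨T, hT, hTapp⟩ := exists_toeplitz_lp (summable_norm_impulseResponse B C D hs)
    (ρ := ρ) fun z hz => by
      rw [(hasSum_transferFunction B C D hs (mem_ball_zero_iff.1 hz).le).tsum_eq]
      exact hρ z hz
  obtain ⟨W, hW⟩ := exists_observability_lp hs C
  obtain ⟨H, hH, hmax, hatt⟩ := exists_isSelfAdjoint_isMaxOn W T (hT.trans_lt hρ1)
  refine ⟨H, hH, fun x => ?_, fun x u => ?_⟩
  · refine le_trans ?_ (hmax x 0)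
    simp
  · obtain ⟨v, hv⟩ := hatt (A x + B u)
    obtain ⟨w, hw0, hw, hwn⟩ := exists_lp_cons u v
    have hzero : (W x + T w) 0 = C x + D u := by
      rw [lp.coeFn_add, Pi.add_apply, hW, hTapp]
      simp [convolve, impulseResponse, hw0]
    have hsucc : ∀ n, (W x + T w) (n + 1) = (W (A x + B u) + T v) n := by
      intro n
      simp only [lp.coeFn_add, Pi.add_apply, hW, hTapp, convolve, Nat.sum_antidiagonal_succ', hw0,
        hw, impulseResponse]
      simp [pow_succ, add_assoc]
    have hnorm : ‖W x + T w‖ ^ 2 = ‖C x + D u‖ ^ 2 + ‖W (A x + B u) + T v‖ ^ 2 := by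
      have h := hasSum_norm_sq (W x + T w)
      rw [← hasSum_nat_add_iff' 1] at h
      simp only [sum_range_one, hsucc, hzero] at h
      linarith [h.unique (hasSum_norm_sq (W (A x + B u) + T v))]
    have := hmax x w
    rw [hnorm, hwn] at this
    rw [hv]
    linarith

end BoundedReal

end StrictBRL

namespace StrictBRL

open ContinuousLinearMap

/-! ### Augmented outputs -/

section Stack

variable {X U Y Z : Type*}
  [NormedAddCommGroup X] [InnerProductSpace ℂ X]
  [NormedAddCommGroup U] [InnerProductSpace ℂ U]
  [NormedAddCommGroup Y] [InnerProductSpace ℂ Y]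
  [NormedAddCommGroup Z] [InnerProductSpace ℂ Z]

/-- The column operator `[C; E] : X → Y ⊕ Z` into the `ℓ²` direct sum. -/
noncomputable def stack (C : X →L[ℂ] Y) (E : X →L[ℂ] Z) : X →L[ℂ] WithLp 2 (Y × Z) :=
  ((WithLp.prodContinuousLinearEquiv 2 ℂ Y Z).symm : Y × Z →L[ℂ] WithLp 2 (Y × Z)) ∘L C.prod E

theorem norm_sq_stack_add (C : X →L[ℂ] Y) (E : X →L[ℂ] Z) (D : U →L[ℂ] Y) (G : U →L[ℂ] Z)
    (x : X) (u : U) :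
    ‖stack C E x + stack D G u‖ ^ 2 = ‖C x + D u‖ ^ 2 + ‖E x + G u‖ ^ 2 := by
  rw [WithLp.prod_norm_sq_eq_of_L2]
  rfl

theorem norm_sq_transferFunction_stack (A : X →L[ℂ] X) (B : U →L[ℂ] X) (C : X →L[ℂ] Y)
    (E : X →L[ℂ] Z) (D : U →L[ℂ] Y) (G : U →L[ℂ] Z) (z : ℂ) (u : U) :
    ‖transferFunction A B (stack C E) (stack D G) z u‖ ^ 2 =
      ‖transferFunction A B C D z u‖ ^ 2 + ‖transferFunction A B E G z u‖ ^ 2 := by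
  rw [WithLp.prod_norm_sq_eq_of_L2]
  rfl

end Stack

/-! ### The KYP inequality and both implications -/

section KYP

variable {X U Y : Type*}
  [NormedAddCommGroup X] [InnerProductSpace ℂ X]
  [NormedAddCommGroup U] [InnerProductSpace ℂ U]
  [NormedAddCommGroup Y] [InnerProductSpace ℂ Y]

theorem re_inner_blockOp_diagonal (H : X →L[ℂ] X) (p : WithLp 2 (X × U)) :
    RCLike.re (inner ℂ (blockOp H 0 0 (ContinuousLinearMap.id ℂ U) p) p) =
      RCLike.re (inner ℂ (H p.fst) p.fst) + ‖p.snd‖ ^ 2 := by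
  rw [← inner_self_eq_norm_sq (𝕜 := ℂ), WithLp.prod_inner_apply, map_add]
  simp [blockOp]

variable [CompleteSpace X] [CompleteSpace U] [CompleteSpace Y]

theorem isSelfAdjoint_blockOp_diagonal {H : X →L[ℂ] X} (hH : IsSelfAdjoint H) :
    IsSelfAdjoint (blockOp H 0 0 (ContinuousLinearMap.id ℂ U)) := by
  rw [ContinuousLinearMap.isSelfAdjoint_iff_isSymmetric] at hH ⊢
  intro p q
  rw [WithLp.prod_inner_apply, WithLp.prod_inner_apply]
  have := hH p.fst q.fst
  simpa [blockOp] using this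

theorem strictKYP_iff_dissipation (A : X →L[ℂ] X) (B : U →L[ℂ] X) (C : X →L[ℂ] Y)
    (D : U →L[ℂ] Y) {H : X →L[ℂ] X} (hH : IsSelfAdjoint H) :
    StrictKYP A B C D H ↔ ∃ δ : ℝ, 0 < δ ∧ ∀ x u,
      RCLike.re (inner ℂ (H (A x + B u)) (A x + B u)) + ‖C x + D u‖ ^ 2 +
        δ * (‖x‖ ^ 2 + ‖u‖ ^ 2) ≤ RCLike.re (inner ℂ (H x) x) + ‖u‖ ^ 2 := by
  have hsa : IsSelfAdjoint (blockOp H 0 0 (ContinuousLinearMap.id ℂ U) -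
      adjoint (blockOp A B C D) ∘L
        blockOp H 0 0 (ContinuousLinearMap.id ℂ Y) ∘L blockOp A B C D) :=
    (isSelfAdjoint_blockOp_diagonal hH).sub
      ((isSelfAdjoint_blockOp_diagonal hH).adjoint_conj (blockOp A B C D))
  have hform : ∀ p : WithLp 2 (X × U),
      RCLike.re (inner ℂ ((blockOp H 0 0 (ContinuousLinearMap.id ℂ U) -
        adjoint (blockOp A B C D) ∘L
          blockOp H 0 0 (ContinuousLinearMap.id ℂ Y) ∘L blockOp A B C D) p) p) =
      RCLike.re (inner ℂ (H p.fst) p.fst) + ‖p.snd‖ ^ 2 -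
        (RCLike.re (inner ℂ (H (A p.fst + B p.snd)) (A p.fst + B p.snd)) +
          ‖C p.fst + D p.snd‖ ^ 2) := by
    intro p
    rw [_root_.sub_apply, inner_sub_left, map_sub, re_inner_blockOp_diagonal,
      ContinuousLinearMap.comp_apply, adjoint_inner_left, ContinuousLinearMap.comp_apply,
      re_inner_blockOp_diagonal]
    rfl
  unfold StrictKYP StrictlyPosDef
  rw [and_iff_right hsa]
  refine exists_congr fun δ => and_congr_right fun _ => ?_
  constructor
  · intro h x u
    have := h (WithLp.toLp 2 (x, u))
    rw [hform, WithLp.prod_norm_sq_eq_of_L2] at this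
    simp only [WithLp.toLp_fst, WithLp.toLp_snd] at this
    linarith
  · intro h p
    rw [hform, WithLp.prod_norm_sq_eq_of_L2]
    linarith [h p.fst p.snd]

theorem strictSchurClass_of_strictKYP {A : X →L[ℂ] X} (hs : Summable fun n : ℕ => ‖A ^ n‖)
    {B : U →L[ℂ] X} {C : X →L[ℂ] Y} {D : U →L[ℂ] Y} {H : X →L[ℂ] X} (hH : StrictlyPosDef H)
    (hKYP : StrictKYP A B C D H) : StrictSchurClass (transferFunction A B C D) := by
  obtain ⟨hHsa, η, hη, hHη⟩ := hH
  obtain ⟨δ, hδ, hdiss⟩ := (strictKYP_iff_dissipation A B C D hHsa).1 hKYP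
  -- `1 - δ` can be negative only when `U` is trivial; the `max` covers that case.
  refine ⟨differentiableOn_transferFunction B C D hs, Real.sqrt (max 0 (1 - δ)), ?_, ?_⟩
  · rw [Real.sqrt_lt' one_pos]
    simp [hδ]
  · intro z hz
    have hz1 := (mem_ball_zero_iff.1 hz).le
    refine ContinuousLinearMap.opNorm_le_bound _ (Real.sqrt_nonneg _) fun u => ?_
    refine abs_le_of_sq_le_sq' ?_ (by positivity) |>.2
    rw [mul_pow, Real.sq_sqrt (le_max_left _ _)]
    set r := Ring.inverse (1 - z • A) (B u) with hr
    have hres : r - z • A r = B u :=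
      DFunLike.congr_fun (Ring.mul_inverse_cancel _ (isUnit_one_sub_smul hs hz1)) (B u)
    have hstate : A (z • r) + B u = r := by
      rw [← hres, map_smul]
      abel
    have hout : transferFunction A B C D z u = C (z • r) + D u := by
      simp [transferFunction, hr, add_comm]
    have hre : RCLike.re (((‖z‖ ^ 2 : ℝ) : ℂ) * inner ℂ (H r) r) =
        ‖z‖ ^ 2 * RCLike.re (inner ℂ (H r) r) := Complex.re_ofReal_mul _ _
    have h := hdiss (z • r) u
    rw [hstate, ← hout, map_smul, inner_smul_left, inner_smul_right, ← mul_assoc,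
      ← Complex.normSq_eq_conj_mul_self, Complex.normSq_eq_norm_sq, hre] at h
    have hpos : 0 ≤ RCLike.re (inner ℂ (H r) r) := le_trans (by positivity) (hHη r)
    have hz2 : ‖z‖ ^ 2 ≤ 1 := pow_le_one₀ (norm_nonneg _) hz1
    have h1 := mul_le_of_le_one_left hpos hz2
    have h2 : 0 ≤ δ * ‖z • r‖ ^ 2 := by positivity
    calc ‖transferFunction A B C D z u‖ ^ 2 ≤ (1 - δ) * ‖u‖ ^ 2 := by linarith
      _ ≤ _ := by
        gcongr
        exact le_max_right _ _

theorem exists_strictKYP_of_norm_transferFunction_le {A : X →L[ℂ] X}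
    (hs : Summable fun n : ℕ => ‖A ^ n‖) {B : U →L[ℂ] X} {C : X →L[ℂ] Y} {D : U →L[ℂ] Y}
    {ρ : ℝ} (hρ1 : ρ < 1)
    (hρ : ∀ z ∈ Metric.ball (0 : ℂ) 1, ‖transferFunction A B C D z‖ ≤ ρ) :
    ∃ H : X →L[ℂ] X, StrictlyPosDef H ∧ StrictKYP A B C D H := by
  have hρ0 : 0 ≤ ρ := (norm_nonneg _).trans (hρ 0 (by simp))
  set k := (∑' n : ℕ, ‖A ^ n‖) * ‖B‖
  -- Since `k` bounds `‖(I - zA)⁻¹B‖` on the disk, the channels `εx` and `εu` add at most `ε²k²` and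
  -- `ε²` to the squared norm.
  obtain ⟨ε, hε, hερ⟩ : ∃ ε : ℝ, 0 < ε ∧ ρ ^ 2 + ε ^ 2 * (k ^ 2 + 1) < 1 := by
    have hc : Filter.Tendsto (fun ε : ℝ => ρ ^ 2 + ε ^ 2 * (k ^ 2 + 1)) (nhdsWithin 0 (Set.Ioi 0))
        (nhds (ρ ^ 2 + 0 ^ 2 * (k ^ 2 + 1))) :=
      tendsto_nhdsWithin_of_tendsto_nhds (Continuous.tendsto (by fun_prop) 0)
    have hlt : ρ ^ 2 + 0 ^ 2 * (k ^ 2 + 1) < 1 := by nlinarith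
    obtain ⟨ε, h1, h2⟩ := ((hc.eventually_lt_const hlt).and self_mem_nhdsWithin).exists
    exact ⟨ε, h2, h1⟩
  let ιX : X →L[ℂ] X := (ε : ℂ) • ContinuousLinearMap.id ℂ X
  let ιU : U →L[ℂ] U := (ε : ℂ) • ContinuousLinearMap.id ℂ U
  obtain ⟨H, hHsa, hH0, hdiss⟩ := exists_storage_of_norm_transferFunction_le hs B
    (stack (stack C ιX) (0 : X →L[ℂ] U)) (stack (stack D (0 : U →L[ℂ] X)) ιU)
    (ρ := Real.sqrt (ρ ^ 2 + ε ^ 2 * (k ^ 2 + 1))) (by rwa [Real.sqrt_lt' one_pos, one_pow])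
    fun z hz => by
      have hz1 := (mem_ball_zero_iff.1 hz).le
      refine ContinuousLinearMap.opNorm_le_bound _ (Real.sqrt_nonneg _) fun u => ?_
      refine abs_le_of_sq_le_sq' ?_ (by positivity) |>.2
      rw [mul_pow, Real.sq_sqrt (by positivity), norm_sq_transferFunction_stack,
        norm_sq_transferFunction_stack]
      have h1 : ‖transferFunction A B C D z u‖ ≤ ρ * ‖u‖ := le_of_opNorm_le _ (hρ z hz) u
      have h2 : ‖transferFunction A B ιX 0 z u‖ ≤ ε * (k * ‖u‖) := by
        have hk : ‖Ring.inverse (1 - z • A) (B u)‖ ≤ k * ‖u‖ := by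
          rw [mul_assoc]
          exact le_of_opNorm_le_of_le _ (norm_inverse_one_sub_smul_le hs hz1) (B.le_opNorm u)
        have : transferFunction A B ιX 0 z u =
            z • (ε : ℂ) • Ring.inverse (1 - z • A) (B u) := by
          simp [transferFunction, ιX]
        rw [this, norm_smul, norm_smul, Complex.norm_of_nonneg hε.le]
        refine (mul_le_of_le_one_left (by positivity) hz1).trans ?_
        gcongr
      have h3 : ‖transferFunction A B (0 : X →L[ℂ] U) ιU z u‖ = ε * ‖u‖ := by
        simp [transferFunction, ιU, norm_smul, abs_of_pos hε]
      rw [h3]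
      calc _ ≤ (ρ * ‖u‖) ^ 2 + (ε * (k * ‖u‖)) ^ 2 + (ε * ‖u‖) ^ 2 := by gcongr
        _ = _ := by ring
  have hdiss' : ∀ x u, RCLike.re (inner ℂ (H (A x + B u)) (A x + B u)) + ‖C x + D u‖ ^ 2 +
      ε ^ 2 * (‖x‖ ^ 2 + ‖u‖ ^ 2) ≤ RCLike.re (inner ℂ (H x) x) + ‖u‖ ^ 2 := by
    intro x u
    have h := hdiss x u
    rw [norm_sq_stack_add, norm_sq_stack_add] at h
    have hx : ‖ιX x + (0 : U →L[ℂ] X) u‖ ^ 2 = ε ^ 2 * ‖x‖ ^ 2 := by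
      simp [ιX, norm_smul, mul_pow]
    have hu : ‖(0 : X →L[ℂ] U) x + ιU u‖ ^ 2 = ε ^ 2 * ‖u‖ ^ 2 := by
      simp [ιU, norm_smul, mul_pow]
    rw [hx, hu] at h
    linarith
  refine ⟨H, ⟨hHsa, ε ^ 2, by positivity, fun x => ?_⟩,
    (strictKYP_iff_dissipation A B C D hHsa).2 ⟨ε ^ 2, by positivity, hdiss'⟩⟩
  -- Zero input gives `⟨Hx, x⟩ ≥ ε²‖x‖²`: the channel `εx` makes `H` coercive without any
  -- observability of `(C, A)`.
  have h := hdiss' x 0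
  simp only [map_zero, add_zero, norm_zero, ne_eq, OfNat.ofNat_ne_zero, not_false_eq_true,
    zero_pow] at h
  linarith [hH0 (A x), sq_nonneg ‖C x‖]

end KYP

end StrictBRL

theorem theorem1p5 {X U Y : Type*}
    [NormedAddCommGroup X] [InnerProductSpace ℂ X] [CompleteSpace X]
    [NormedAddCommGroup U] [InnerProductSpace ℂ U] [CompleteSpace U]
    [NormedAddCommGroup Y] [InnerProductSpace ℂ Y] [CompleteSpace Y]
    (A : X →L[ℂ] X) (B : U →L[ℂ] X) (C : X →L[ℂ] Y) (D : U →L[ℂ] Y)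
    (hA : spectralRadius ℂ A < 1) :
    StrictBRL.StrictSchurClass (StrictBRL.transferFunction A B C D) ↔
      ∃ H : X →L[ℂ] X, StrictBRL.StrictlyPosDef H ∧ StrictBRL.StrictKYP A B C D H := by
  have hs := StrictBRL.summable_norm_pow_of_spectralRadius_lt_one hA
  constructor
  · rintro ⟨-, ρ, hρ1, hρ⟩
    exact StrictBRL.exists_strictKYP_of_norm_transferFunction_le hs hρ1 hρ
  · rintro ⟨H, hH, hKYP⟩
    exact StrictBRL.strictSchurClass_of_strictKYP hs hH hKYP
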